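/- **Theorem (One-bit recovery).** Let $S$ be a measurable space, $\nu$ a probability measure on $S$ (the law of the noise), and $\theta:\mathbb{R}\times S\to\mathbb{R}$ a measurable, possibly random transformation: $\theta(z,s)$ is the value observed for intensity $z$ when the noise takes the value $s$ (a deterministic $\theta$ does not depend on $s$). Let $\operatorname{sign}(t)=1$ for $t>0$, $\operatorname{sign}(t)=-1$ for $t<0$, and let $\operatorname{sign}(0)\in\{-1,0,1\}$ be any fixed convention. Put $$\lambda=\mathbb{E}\big[\operatorname{sign}\big(\theta(E_1,s_1)-\theta(E_2,s_2)\big)(E_1-E_2)\big],$$ where $E_1,E_2\sim\mathrm{Exp}(1)$ and $s_1,s_2\sim\nu$ are independent, and assume $\lambda>0$. For $x_0\in\mathbb{C}^n$ with $\|x_0\|=1$, let $(a^1_i,a^2_i,s^1_i,s^2_i)$, $i=1,\dots,m$, be i.i.d., where $a^1_i,a^2_i\sim\mathcal{N}(0,\tfrac12 I_n)+i\,\mathcal{N}(0,\tfrac12 I_n)$ and $s^1_i,s^2_i\sim\nu$ are independent, and let $$y_i=\operatorname{sign}\big(\theta(|\langle a^1_i,x_0\rangle|^2,s^1_i)-\theta(|\langle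 a^2_i,x_0\rangle|^2,s^2_i)\big),\qquad \hat C_m=\frac1m\sum_{i=1}^m y_i\big(a^1_i a^{1,*}_i-a^2_i a^{2,*}_i\big).$$ There are absolute constants $C,K>0$ and, for every value $\lambda>0$, an integer $N$ depending only on $\lambda$, such that for all such $\theta,\nu$ with parameter $\lambda$, all $n\ge N$, all unit vectors $x_0\in\mathbb{C}^n$, all $\epsilon\in(0,1]$ and all $$m\ \ge\ \frac{C}{\epsilon^2\lambda}\,n\log n,$$ the following holds with probability at least $1-K/n^2$: every top eigenvector $\hat x_m$ of $\hat C_m$, that is, every unit vector that maximizes $x^*\hat C_m x$ over the unit sphere of $\mathbb{C}^n$, satisfies $\|\hat x_m-e^{i\phi}x_0\|^2\le\epsilon$ for some $\phi\in[0,2\pi]$. -/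

import Mathlib

open MeasureTheory ProbabilityTheory

namespace OneBitPhase

/-- The standard complex Gaussian law `N(0, 1/2) + i N(0, 1/2)` on `ℂ`. -/
noncomputable def complexGaussian : Measure ℂ :=
  ((gaussianReal 0 (1 / 2)).prod (gaussianReal 0 (1 / 2))).map
    (fun p : ℝ × ℝ => (⟨p.1, p.2⟩ : ℂ))

/-- The law `N(0, I_n / 2) + i N(0, I_n / 2)` of a standard complex Gaussian vector in `ℂⁿ`. -/
noncomputable def complexGaussianVector (n : ℕ) : Measure (EuclideanSpace ℂ (Fin n)) :=
  (Measure.pi (fun _ : Fin n => complexGaussian)).map (WithLp.toLp 2)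

/-- The sign function; `τ` is the value in `{-1, 0, 1}` that a tie receives. -/
noncomputable def sgn (τ : SignType) (t : ℝ) : ℝ :=
  if 0 < t then 1 else if t < 0 then -1 else (τ : ℝ)

/-- The signal-to-noise parameter `λ = E[sign(θ(E₁) - θ(E₂)) (E₁ - E₂)]` of a possibly random
transformation of intensities: `θ z s` is the observed value when the intensity is `z` and the
noise takes the value `s`, and `ν` is the law of the noise. Here `E₁, E₂ ∼ Exp(1)` and the two
noise variables are independent. A deterministic `θ` is one that does not depend on `s`. -/
noncomputable def snr {S : Type*} [MeasurableSpace S] (τ : SignType) (ν : Measure S)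
    (θ : ℝ → S → ℝ) : ℝ :=
  ∫ p : (ℝ × ℝ) × (S × S),
    sgn τ (θ p.1.1 p.2.1 - θ p.1.2 p.2.2) * (p.1.1 - p.1.2)
      ∂(((expMeasure 1).prod (expMeasure 1)).prod (ν.prod ν))

/-- One pair of measurements: the two sensing vectors and the two noise values. -/
abbrev Sample (n : ℕ) (S : Type*) : Type _ :=
  (EuclideanSpace ℂ (Fin n) × EuclideanSpace ℂ (Fin n)) × (S × S)

/-- The law of one pair of measurements: the two sensing vectors are standard complex Gaussian,
the two noise values have law `ν`, and all four are independent. -/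
noncomputable def sampleLaw {S : Type*} [MeasurableSpace S] (n : ℕ) (ν : Measure S) :
    Measure (Sample n S) :=
  ((complexGaussianVector n).prod (complexGaussianVector n)).prod (ν.prod ν)

/-- The one-bit measurement `y = sign(θ(|⟨a¹, x₀⟩|²) - θ(|⟨a², x₀⟩|²))`. -/
noncomputable def oneBit {S : Type*} {n : ℕ} (τ : SignType) (θ : ℝ → S → ℝ)
    (x₀ : EuclideanSpace ℂ (Fin n)) (A : Sample n S) : ℝ :=
  sgn τ (θ (‖inner ℂ A.1.1 x₀‖ ^ 2) A.2.1 - θ (‖inner ℂ A.1.2 x₀‖ ^ 2) A.2.2)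

/-- The rank one matrix `a a*`. -/
noncomputable def outer {n : ℕ} (a : EuclideanSpace ℂ (Fin n)) : Matrix (Fin n) (Fin n) ℂ :=
  Matrix.vecMulVec a.ofLp (star a.ofLp)

/-- The matrix `Ĉ_m = (1/m) ∑ y_i (a¹_i a¹_i* - a²_i a²_i*)`. -/
noncomputable def empiricalMatrix {S : Type*} {n m : ℕ} (τ : SignType) (θ : ℝ → S → ℝ)
    (x₀ : EuclideanSpace ℂ (Fin n)) (A : Fin m → Sample n S) : Matrix (Fin n) (Fin n) ℂ :=
  (1 / (m : ℂ)) • ∑ i, (oneBit τ θ x₀ (A i) : ℂ) • (outer (A i).1.1 - outer (A i).1.2)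

/-- `x` is a top eigenvector of the Hermitian matrix `M`: a unit vector that maximizes `x* M x`
over the unit sphere. -/
def IsTopEigenvector {n : ℕ} (M : Matrix (Fin n) (Fin n) ℂ)
    (x : EuclideanSpace ℂ (Fin n)) : Prop :=
  ‖x‖ = 1 ∧ ∀ z : EuclideanSpace ℂ (Fin n), ‖z‖ = 1 →
    (star z.ofLp ⬝ᵥ M.mulVec z.ofLp).re ≤ (star x.ofLp ⬝ᵥ M.mulVec x.ofLp).re

end OneBitPhase

/-!
The quadratic form of the empirical matrix at `x` is the empirical mean of independent copies of
the contrast `y (|⟨a¹, x⟩|² - |⟨a², x⟩|²)`.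

*Mean.* A unit vector `x` is `⟨x₀, x⟩ x₀ + w` with `w` orthogonal to `x₀`. For a complex Gaussian
vector `a`, the variables `⟨a, x₀⟩` and `⟨a, w⟩` are centred and independent
(`indepFun_inner_of_inner_eq_zero`), so the cross terms vanish, and the contributions
`‖w‖² E y` of `w` to the two intensities cancel. Since `|⟨a, x₀⟩|²` is exponential
(`map_norm_inner_sq`), the mean of the contrast is `λ |⟨x₀, x⟩|²` (`integral_contrast`), that is,
the quadratic form of `λ x₀ x₀*`.

*Concentration.* The contrast is dominated by a sum of two exponential variables, so Bernstein's
inequality (`measureReal_mean_sub_ge_le`) gives Gaussian tails at each fixed `x`. The unit sphere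
of `ℂⁿ` has a `1/2`-net with at most `5 ^ (2 n)` points (`exists_half_net_sphere`), and a quadratic
form is at most `32` times as large on the sphere as on the net (`abs_le_of_net`). Hence, outside
an event of probability at most `2 * 5 ^ (2 n) * exp (- m t² / 512)`, the two quadratic forms
differ by at most `32 t` on the whole sphere (`measureReal_exists_net_le`).

*Perturbation.* If they differ by at most `λ ε / 4`, maximality of a top eigenvector `x` forces
`|⟨x₀, x⟩|² ≥ 1 - ε / 2`, and `x` is close to `x₀` up to a phase
(`exists_phase_of_isTopEigenvector`).

With `t = λ ε / 128` the exponent `m t² / 512` is a constant multiple of `m λ² ε²`, which is at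
least `λ n log n` by the assumption on `m`. The net argument only needs a large multiple of `n`
here. So the factor `log n` is spent on `1 / λ` and on the numerical constants, and this is why
`N` depends on `λ` while the absolute constants can be taken to be `C = 1` and `K = 2`.
-/

namespace OneBitPhase

/-! ### Quadratic forms on a net of the sphere -/

/-- A maximal `1/2`-separated subset of the unit sphere is a `1/2`-net, and the volume argument
behind the Besicovitch covering theorem bounds its size. -/
lemma exists_half_net_sphere (E : Type*) [NormedAddCommGroup E] [NormedSpace ℝ E]
    [FiniteDimensional ℝ E] :
    ∃ N : Finset E, N.card ≤ 5 ^ Module.finrank ℝ E ∧ (∀ y ∈ N, ‖y‖ = 1) ∧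
      ∀ x : E, ‖x‖ = 1 → ∃ y ∈ N, ‖x - y‖ ≤ 1 / 2 := by
  classical
  have key : ∀ s : Finset E, (s : Set E) ⊆ Metric.sphere 0 1 →
      Metric.IsSeparated ((1 / 2 : NNReal) : ENNReal) (s : Set E) →
      s.card ≤ 5 ^ Module.finrank ℝ E := by
    intro s hs hsep
    -- doubling turns `1/2`-separated unit vectors into `1`-separated vectors of norm `2`
    have hinj : Function.Injective (fun x : E => (2 : ℝ) • x) :=
      smul_right_injective E two_ne_zero
    rw [← Finset.card_image_of_injective s hinj]
    refine Besicovitch.card_le_of_separated _ ?_ ?_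
    · intro c hc
      obtain ⟨x, hx, rfl⟩ := Finset.mem_image.1 hc
      have : ‖x‖ = 1 := by simpa using hs hx
      simp [norm_smul, this]
    · intro c hc d hd hcd
      obtain ⟨x, hx, rfl⟩ := Finset.mem_image.1 hc
      obtain ⟨y, hy, rfl⟩ := Finset.mem_image.1 hd
      have hxy : x ≠ y := fun h => hcd (by rw [h])
      have h : ((1 / 2 : NNReal) : ENNReal) < edist x y := hsep hx hy hxy
      rw [edist_nndist, ENNReal.coe_lt_coe, ← NNReal.coe_lt_coe, coe_nndist, dist_eq_norm] at h
      rw [← smul_sub, norm_smul]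
      norm_num at h ⊢
      linarith
  have hpack : Metric.packingNumber (1 / 2 : NNReal) (Metric.sphere (0 : E) 1) ≤
      (5 ^ Module.finrank ℝ E : ℕ) := by
    refine iSup₂_le fun C hC => iSup_le fun hsep => ?_
    by_contra! hlt
    have hle : ((5 ^ Module.finrank ℝ E + 1 : ℕ) : ℕ∞) ≤ C.encard := by
      push_cast at hlt ⊢
      exact Order.add_one_le_of_lt hlt
    obtain ⟨r, hrC, hr⟩ := Set.exists_subset_encard_eq hle
    have hfin : r.Finite := Set.finite_of_encard_eq_coe hr
    have := key hfin.toFinset (by simpa using hrC.trans hC) (by simpa using hsep.subset hrC)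
    rw [hfin.encard_eq_coe_toFinset_card, Nat.cast_inj] at hr
    omega
  have htop : Metric.packingNumber (1 / 2 : NNReal) (Metric.sphere (0 : E) 1) ≠ ⊤ :=
    ne_top_of_le_ne_top (ENat.natCast_ne_top _) hpack
  obtain ⟨C, hC, hfin, hcov, hcard⟩ := Metric.exists_set_encard_eq_coveringNumber
    (ne_top_of_le_ne_top htop (Metric.coveringNumber_le_packingNumber _ _))
  refine ⟨hfin.toFinset, ?_, ?_, ?_⟩
  · have h := hcard.le.trans ((Metric.coveringNumber_le_packingNumber _ _).trans hpack)
    rw [hfin.encard_eq_coe_toFinset_card] at h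
    exact_mod_cast h
  · intro y hy
    simpa using hC (hfin.mem_toFinset.1 hy)
  · intro x hx
    obtain ⟨y, hy, hxy⟩ := hcov (show x ∈ Metric.sphere (0 : E) 1 by simpa using hx)
    refine ⟨y, hfin.mem_toFinset.2 hy, ?_⟩
    replace hxy : edist x y ≤ ((1 / 2 : NNReal) : ENNReal) := hxy
    rw [edist_nndist, ENNReal.coe_le_coe, ← NNReal.coe_le_coe, coe_nndist, dist_eq_norm] at hxy
    simpa using hxy

/-- A real quadratic form is controlled on the whole sphere by its values on a `1/2`-net. -/
lemma abs_le_of_net {E : Type*} [NormedAddCommGroup E] [InnerProductSpace ℝ E]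
    [FiniteDimensional ℝ E] {q : E → ℝ} {B : E → E → ℝ} (hcont : Continuous q)
    (hq : ∀ (a b : ℝ) (x y : E), q (a • x + b • y) = a ^ 2 * q x + b ^ 2 * q y + a * b * B x y)
    {N : Finset E} (hN : ∀ y ∈ N, ‖y‖ = 1)
    (hnet : ∀ x : E, ‖x‖ = 1 → ∃ y ∈ N, ‖x - y‖ ≤ 1 / 2)
    {t : ℝ} (ht : ∀ y ∈ N, |q y| ≤ t) {x : E} (hx : ‖x‖ = 1) : |q x| ≤ 32 * t := by
  obtain ⟨z, hz, hmax⟩ := (isCompact_sphere (0 : E) 1).exists_isMaxOn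
    ⟨x, by simpa using hx⟩ (hcont.abs.continuousOn)
  replace hz : ‖z‖ = 1 := by simpa using hz
  have hmax' : ∀ v : E, |q v| ≤ |q z| * ‖v‖ ^ 2 := by
    intro v
    have hsmul : ∀ (a : ℝ) (w : E), q (a • w) = a ^ 2 * q w := by
      intro a w
      simpa using hq a 0 w w
    rcases eq_or_ne v 0 with rfl | hv
    · have := hsmul 0 0
      rw [smul_zero] at this
      rw [this]
      simp
    · have hv' : ‖v‖ ≠ 0 := norm_ne_zero_iff.2 hv
      have hunit : ‖(‖v‖⁻¹ : ℝ) • v‖ = 1 := by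
        rw [norm_smul, norm_inv, norm_norm, inv_mul_cancel₀ hv']
      have h1 : |q ((‖v‖⁻¹ : ℝ) • v)| ≤ |q z| := hmax (by simpa using hunit)
      have h2 : q v = ‖v‖ ^ 2 * q ((‖v‖⁻¹ : ℝ) • v) := by
        rw [hsmul]
        field_simp
      rw [h2, abs_mul, abs_of_nonneg (sq_nonneg ‖v‖), mul_comm]
      gcongr
  obtain ⟨y, hyN, hzy⟩ := hnet z hz
  have hy := hN y hyN
  -- the coefficients are chosen so that the cross terms cancel and both vectors are short
  have h4 : 4 * (q z - q y) =
      q ((5 / 2 : ℝ) • z + (-3 / 2 : ℝ) • y) - q ((3 / 2 : ℝ) • z + (-5 / 2 : ℝ) • y) := by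
    rw [hq, hq]
    ring
  have hin : inner ℝ z y ≥ 7 / 8 := by
    have h := norm_sub_sq_real z y
    have : ‖z - y‖ ^ 2 ≤ (1 / 2) ^ 2 := by gcongr
    rw [hz, hy] at h
    nlinarith
  have hn1 : ‖(5 / 2 : ℝ) • z + (-3 / 2 : ℝ) • y‖ ^ 2 ≤ 31 / 16 := by
    rw [norm_add_sq_real, norm_smul, norm_smul, inner_smul_left, inner_smul_right, hz, hy]
    norm_num
    linarith
  have hn2 : ‖(3 / 2 : ℝ) • z + (-5 / 2 : ℝ) • y‖ ^ 2 ≤ 31 / 16 := by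
    rw [norm_add_sq_real, norm_smul, norm_smul, inner_smul_left, inner_smul_right, hz, hy]
    norm_num
    linarith
  have hb1 := (hmax' _).trans (mul_le_mul_of_nonneg_left hn1 (abs_nonneg (q z)))
  have hb2 := (hmax' _).trans (mul_le_mul_of_nonneg_left hn2 (abs_nonneg (q z)))
  have hdiff : 4 * |q z - q y| ≤ |q z| * (31 / 16) + |q z| * (31 / 16) := by
    have : 4 * |q z - q y| = |4 * (q z - q y)| := by rw [abs_mul]; norm_num
    rw [this, h4]
    exact (abs_sub _ _).trans (add_le_add hb1 hb2)
  have htri : |q z| ≤ |q y| + |q z - q y| := by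
    have := abs_add_le (q y) (q z - q y)
    simpa using this
  have h1 : |q x| ≤ |q z| := hmax (by simpa using hx)
  have := ht y hyN
  linarith

/-! ### Bernstein's inequality -/

lemma exp_le_one_add_add_sq_mul_exp_abs (t : ℝ) :
    Real.exp t ≤ 1 + t + t ^ 2 * Real.exp |t| := by
  have h := Complex.norm_exp_sub_sum_le_norm_mul_exp (t : ℂ) 2
  have h2 : Complex.exp t - ∑ i ∈ Finset.range 2, (t : ℂ) ^ i / (i.factorial : ℂ) =
      ((Real.exp t - (1 + t) : ℝ) : ℂ) := by
    simp [Finset.sum_range_succ]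
  rw [h2, Complex.norm_real, Complex.norm_real, Real.norm_eq_abs, Real.norm_eq_abs, sq_abs] at h
  linarith [le_abs_self (Real.exp t - (1 + t))]

/-- A random variable with a bounded exponential moment has a moment generating function of
Gaussian type near the origin. -/
lemma mgf_le_of_integral_exp_abs_le {Ω : Type*} [MeasurableSpace Ω] {P : Measure Ω}
    [IsProbabilityMeasure P] {X : Ω → ℝ} (hX : AEMeasurable X P)
    (hint : Integrable (fun ω => Real.exp (|X ω| / 2)) P)
    (hle : ∫ ω, Real.exp (|X ω| / 2) ∂P ≤ 4) {s : ℝ} (hs : |s| ≤ 1 / 4) :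
    Integrable (fun ω => Real.exp (s * X ω)) P ∧
      mgf X P s ≤ Real.exp (s * ∫ ω, X ω ∂P + 128 * s ^ 2) := by
  have hXi : Integrable X P := by
    refine (hint.const_mul 2).mono' hX.aestronglyMeasurable (.of_forall fun ω => ?_)
    have := Real.add_one_le_exp (|X ω| / 2)
    rw [Real.norm_eq_abs]
    linarith
  have hbd : ∀ x : ℝ, Real.exp (s * x) ≤ 1 + s * x + 32 * s ^ 2 * Real.exp (|x| / 2) := by
    intro x
    have h1 := exp_le_one_add_add_sq_mul_exp_abs (s * x)
    have h2 : |s * x| ≤ |x| / 4 := by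
      rw [abs_mul]
      nlinarith [abs_nonneg x]
    have h3 : x ^ 2 ≤ 32 * Real.exp (|x| / 4) := by
      have := Real.quadratic_le_exp_of_nonneg (x := |x| / 4) (by positivity)
      nlinarith [abs_nonneg x, sq_abs x]
    have h4 : Real.exp (|x| / 2) = Real.exp (|x| / 4) * Real.exp (|x| / 4) := by
      rw [← Real.exp_add]; ring_nf
    have h5 : (s * x) ^ 2 * Real.exp |s * x| ≤ 32 * s ^ 2 * Real.exp (|x| / 2) := by
      rw [h4, mul_pow]
      calc s ^ 2 * x ^ 2 * Real.exp |s * x|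
          ≤ s ^ 2 * (32 * Real.exp (|x| / 4)) * Real.exp (|x| / 4) := by gcongr
        _ = _ := by ring
    linarith
  have hi : Integrable (fun ω => 1 + s * X ω + 32 * s ^ 2 * Real.exp (|X ω| / 2)) P :=
    ((integrable_const 1).add (hXi.const_mul s)).add (hint.const_mul _)
  have hint' : Integrable (fun ω => Real.exp (s * X ω)) P := by
    refine hi.mono' (by fun_prop) (.of_forall fun ω => ?_)
    rw [Real.norm_eq_abs, abs_of_pos (Real.exp_pos _)]
    exact hbd _
  refine ⟨hint', ?_⟩
  calc mgf X P s ≤ ∫ ω, (1 + s * X ω + 32 * s ^ 2 * Real.exp (|X ω| / 2)) ∂P :=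
        integral_mono hint' hi fun ω => hbd _
    _ = 1 + s * ∫ ω, X ω ∂P + 32 * s ^ 2 * ∫ ω, Real.exp (|X ω| / 2) ∂P := by
        rw [integral_add (f := fun ω => 1 + s * X ω)
            ((integrable_const 1).add (hXi.const_mul s)) (hint.const_mul _),
          integral_add (integrable_const 1) (hXi.const_mul s), integral_const_mul,
          integral_const_mul]
        simp
    _ ≤ (s * ∫ ω, X ω ∂P + 128 * s ^ 2) + 1 := by nlinarith [sq_nonneg s]
    _ ≤ _ := Real.add_one_le_exp _

/-- One-sided Bernstein inequality in the range of deviations where the tail is Gaussian. -/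
lemma measureReal_sum_ge_le {Ω : Type*} [MeasurableSpace Ω] {P : Measure Ω}
    [IsProbabilityMeasure P] {m : ℕ} {X : Fin m → Ω → ℝ} {μ : ℝ}
    (hX : ∀ i, AEMeasurable (X i) P) (hindep : iIndepFun X P)
    (hint : ∀ i, Integrable (fun ω => Real.exp (|X i ω| / 2)) P)
    (hle : ∀ i, ∫ ω, Real.exp (|X i ω| / 2) ∂P ≤ 4) (hμ : ∀ i, ∫ ω, X i ω ∂P = μ)
    {t : ℝ} (ht : 0 ≤ t) (ht' : t ≤ 64) :
    P.real {ω | m * (μ + t) ≤ ∑ i, X i ω} ≤ Real.exp (-(m * t ^ 2 / 512)) := by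
  -- the exponent `128 s² - s t` is minimal at `s = t / 256`
  have hs : |t / 256| ≤ 1 / 4 := by rw [abs_of_nonneg (by positivity)]; linarith
  have hm := fun i => mgf_le_of_integral_exp_abs_le (hX i) (hint i) (hle i) hs
  have hI : Integrable (fun ω => Real.exp (t / 256 * (∑ i, X i) ω)) P := by
    -- a non-integrable exponential would have integral zero, but the product is positive
    by_contra hI
    have hpos : 0 < mgf (∑ i, X i) P (t / 256) := by
      rw [hindep.mgf_sum₀ hX]
      exact Finset.prod_pos fun i _ => mgf_pos (hm i).1
    exact hpos.ne' (integral_undef hI)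
  have h := measure_ge_le_exp_mul_mgf (μ := P) (X := ∑ i, X i) (m * (μ + t))
    (show 0 ≤ t / 256 by positivity) hI
  simp only [Finset.sum_apply] at h
  refine h.trans ?_
  rw [hindep.mgf_sum₀ hX]
  calc Real.exp (-(t / 256) * (m * (μ + t))) * ∏ i, mgf (X i) P (t / 256)
      ≤ Real.exp (-(t / 256) * (m * (μ + t))) *
          ∏ _i : Fin m, Real.exp (t / 256 * μ + 128 * (t / 256) ^ 2) := by
        gcongr with i
        · exact fun i _ => mgf_nonneg
        · rw [← hμ i]; exact (hm i).2
    _ = Real.exp (-(m * t ^ 2 / 512)) := by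
        rw [Finset.prod_const, Finset.card_univ, Fintype.card_fin, ← Real.exp_nat_mul,
          ← Real.exp_add]
        congr 1
        ring

/-- Two-sided Bernstein inequality for the empirical mean. -/
lemma measureReal_mean_sub_ge_le {Ω : Type*} [MeasurableSpace Ω] {P : Measure Ω}
    [IsProbabilityMeasure P] {m : ℕ} (hm : 0 < m) {X : Fin m → Ω → ℝ} {μ : ℝ}
    (hX : ∀ i, AEMeasurable (X i) P) (hindep : iIndepFun X P)
    (hint : ∀ i, Integrable (fun ω => Real.exp (|X i ω| / 2)) P)
    (hle : ∀ i, ∫ ω, Real.exp (|X i ω| / 2) ∂P ≤ 4) (hμ : ∀ i, ∫ ω, X i ω ∂P = μ)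
    {t : ℝ} (ht : 0 ≤ t) (ht' : t ≤ 64) :
    P.real {ω | t ≤ |(1 / m : ℝ) * ∑ i, X i ω - μ|} ≤
      2 * Real.exp (-(m * t ^ 2 / 512)) := by
  have hm' : (0 : ℝ) < m := by exact_mod_cast hm
  have h1 := measureReal_sum_ge_le hX hindep hint hle hμ ht ht'
  have h2 := measureReal_sum_ge_le (X := fun i ω => -X i ω) (μ := -μ)
    (fun i => (hX i).neg) (hindep.comp (fun _ x => -x) fun _ => measurable_neg)
    (by simpa using hint) (by simpa using hle) (by simpa [integral_neg] using hμ) ht ht'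
  have hsub : {ω | t ≤ |(1 / m : ℝ) * ∑ i, X i ω - μ|} ⊆
      {ω | m * (μ + t) ≤ ∑ i, X i ω} ∪ {ω | m * (-μ + t) ≤ ∑ i, -X i ω} := by
    intro ω hω
    simp only [Set.mem_ofPred_eq, Set.mem_union, Finset.sum_neg_distrib] at hω ⊢
    have hS : ∑ i, X i ω = m * ((1 / m : ℝ) * ∑ i, X i ω) := by field_simp
    rcases le_abs'.1 hω with h | h
    · right
      rw [hS]
      nlinarith
    · left
      rw [hS]
      nlinarith
  calc _ ≤ _ := measureReal_mono hsub
    _ ≤ _ := measureReal_union_le _ _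
    _ ≤ _ := by linarith

/-! ### Complex Gaussian vectors -/

instance : IsProbabilityMeasure complexGaussian := by
  refine Measure.isProbabilityMeasure_map (Measurable.aemeasurable ?_)
  exact Complex.measurableEquivRealProd.symm.measurable

instance (n : ℕ) : IsProbabilityMeasure (complexGaussianVector n) :=
  Measure.isProbabilityMeasure_map (by fun_prop)

instance : IsProbabilityMeasure (expMeasure 1) := isProbabilityMeasure_expMeasure one_pos

lemma integral_complexGaussian (f : ℂ → ℂ) :
    ∫ z, f z ∂complexGaussian =
      ∫ p : ℝ × ℝ, f ⟨p.1, p.2⟩ ∂((gaussianReal 0 (1 / 2)).prod (gaussianReal 0 (1 / 2))) :=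
  MeasureTheory.integral_map_equiv Complex.measurableEquivRealProd.symm f

lemma integral_cexp_inner_complexGaussian (z : ℂ) :
    ∫ w, Complex.exp ((inner ℂ w z).re * Complex.I) ∂complexGaussian =
      Complex.exp (-(‖z‖ ^ 2 / 4 : ℝ)) := by
  have hsplit : ∀ p : ℝ × ℝ, Complex.exp ((inner ℂ (⟨p.1, p.2⟩ : ℂ) z).re * Complex.I) =
      Complex.exp (z.re * p.1 * Complex.I) * Complex.exp (z.im * p.2 * Complex.I) := by
    intro p
    rw [← Complex.exp_add]
    congr 1
    simp
    ring
  rw [integral_complexGaussian]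
  simp_rw [hsplit]
  rw [integral_prod_mul (fun x : ℝ => Complex.exp (z.re * x * Complex.I))
    (fun x : ℝ => Complex.exp (z.im * x * Complex.I)),
    ← charFun_apply_real, ← charFun_apply_real, charFun_gaussianReal, charFun_gaussianReal,
    ← Complex.exp_add, Complex.sq_norm, Complex.normSq_apply]
  congr 1
  push_cast
  ring

/-- The characteristic function of the standard complex Gaussian vector. -/
lemma integral_cexp_inner_complexGaussianVector {n : ℕ} (x : EuclideanSpace ℂ (Fin n)) :
    ∫ a, Complex.exp ((inner ℂ a x).re * Complex.I) ∂complexGaussianVector n =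
      Complex.exp (-(‖x‖ ^ 2 / 4 : ℝ)) := by
  have hsplit : ∀ a : Fin n → ℂ,
      Complex.exp ((inner ℂ (WithLp.toLp 2 a) x).re * Complex.I) =
        ∏ i, Complex.exp ((inner ℂ (a i) (x i)).re * Complex.I) := by
    intro a
    rw [← Complex.exp_sum, PiLp.inner_apply, Complex.re_sum]
    push_cast
    rw [Finset.sum_mul]
  rw [complexGaussianVector, integral_map (by fun_prop) (by fun_prop)]
  simp_rw [hsplit]
  rw [integral_fintype_prod_eq_prod
    (f := fun i (w : ℂ) => Complex.exp ((inner ℂ w (x i)).re * Complex.I))]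
  simp_rw [integral_cexp_inner_complexGaussian]
  rw [← Complex.exp_sum, EuclideanSpace.norm_sq_eq]
  congr 1
  push_cast
  rw [Finset.sum_neg_distrib, Finset.sum_div]

lemma charFun_complexGaussian (z : ℂ) :
    charFun complexGaussian z = Complex.exp (-(‖z‖ ^ 2 / 4 : ℝ)) := by
  rw [charFun_apply, ← integral_cexp_inner_complexGaussian]
  rfl

lemma inner_real_inner {n : ℕ} (a x : EuclideanSpace ℂ (Fin n)) (z : ℂ) :
    inner ℝ (inner ℂ a x) z = (inner ℂ a ((starRingEnd ℂ) z • x)).re := by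
  rw [inner_smul_right, Complex.inner]
  generalize (inner ℂ a x : ℂ) = u
  simp

lemma charFun_map_inner {n : ℕ} (x : EuclideanSpace ℂ (Fin n)) (z : ℂ) :
    charFun ((complexGaussianVector n).map (fun a => inner ℂ a x)) z =
      Complex.exp (-(‖z‖ ^ 2 * ‖x‖ ^ 2 / 4 : ℝ)) := by
  rw [charFun_apply, integral_map (by fun_prop) (by fun_prop)]
  simp_rw [inner_real_inner]
  rw [integral_cexp_inner_complexGaussianVector, norm_smul, RCLike.norm_conj, mul_pow]

lemma map_inner_complexGaussianVector {n : ℕ} {x : EuclideanSpace ℂ (Fin n)} (hx : ‖x‖ = 1) :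
    (complexGaussianVector n).map (fun a => inner ℂ a x) = complexGaussian := by
  have : IsProbabilityMeasure ((complexGaussianVector n).map (fun a => inner ℂ a x)) :=
    Measure.isProbabilityMeasure_map (by fun_prop)
  refine Measure.ext_of_charFun (funext fun z => ?_)
  rw [charFun_map_inner, charFun_complexGaussian, hx]
  norm_num

/-- Orthogonal linear functionals of a complex Gaussian vector are independent. -/
lemma indepFun_inner_of_inner_eq_zero {n : ℕ} {x w : EuclideanSpace ℂ (Fin n)}
    (h : inner ℂ x w = 0) :
    IndepFun (fun a => inner ℂ a x) (fun a => inner ℂ a w) (complexGaussianVector n) := by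
  rw [indepFun_iff_charFun_prod (by fun_prop) (by fun_prop)]
  intro t
  rw [charFun_map_inner, charFun_map_inner, ← Complex.exp_add, charFun_apply,
    integral_map (by fun_prop) (by fun_prop)]
  have hsum : ∀ a : EuclideanSpace ℂ (Fin n),
      inner ℝ (WithLp.toLp 2 ((inner ℂ a x : ℂ), (inner ℂ a w : ℂ))) t =
        (inner ℂ a ((starRingEnd ℂ) t.ofLp.1 • x + (starRingEnd ℂ) t.ofLp.2 • w)).re := by
    intro a
    rw [inner_add_right, Complex.add_re, ← inner_real_inner, ← inner_real_inner]
    rfl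
  simp_rw [hsum]
  rw [integral_cexp_inner_complexGaussianVector]
  congr 1
  have hpyth : ‖(starRingEnd ℂ) t.ofLp.1 • x + (starRingEnd ℂ) t.ofLp.2 • w‖ ^ 2 =
      ‖t.ofLp.1‖ ^ 2 * ‖x‖ ^ 2 + ‖t.ofLp.2‖ ^ 2 * ‖w‖ ^ 2 := by
    rw [norm_add_sq (𝕜 := ℂ), inner_smul_left, inner_smul_right, h]
    simp [norm_smul, mul_pow]
  rw [hpyth]
  push_cast
  ring

/-! ### Intensities are exponential -/

lemma integral_expMeasure {E : Type*} [NormedAddCommGroup E] [NormedSpace ℝ E] (f : ℝ → E) :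
    ∫ x, f x ∂expMeasure 1 = ∫ x in Set.Ioi 0, Real.exp (-x) • f x := by
  have hm : Measurable (exponentialPDF 1) := (measurable_exponentialPDFReal 1).ennreal_ofReal
  change ∫ x, f x ∂(volume.withDensity (exponentialPDF 1)) = _
  rw [integral_withDensity_eq_integral_toReal_smul hm
    (.of_forall fun x => ENNReal.ofReal_lt_top), ← integral_Ici_eq_integral_Ioi,
    ← integral_indicator measurableSet_Ici]
  refine integral_congr_ae (.of_forall fun x => ?_)
  dsimp only
  rw [exponentialPDF_eq]
  by_cases hx : 0 ≤ x
  · simp [hx, Real.exp_nonneg]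
  · simp [hx]

lemma integral_cexp_mul_sq_gaussianReal (t : ℝ) :
    (∫ x, Complex.exp (t * x ^ 2 * Complex.I) ∂gaussianReal 0 (1 / 2)) ^ 2 =
      1 / (1 - t * Complex.I) := by
  rw [integral_gaussianReal_eq_integral_smul (by norm_num)]
  have hb : 0 < (1 - t * Complex.I).re := by simp
  have h : ∀ x : ℝ, gaussianPDFReal 0 (1 / 2) x • Complex.exp (t * x ^ 2 * Complex.I) =
      ((Real.sqrt Real.pi)⁻¹ : ℝ) * Complex.exp (-(1 - t * Complex.I) * x ^ 2) := by
    intro x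
    rw [gaussianPDFReal, Complex.real_smul]
    push_cast
    rw [mul_assoc, ← Complex.exp_add]
    have h2 : ((Real.sqrt 2 : ℝ) : ℂ) ≠ 0 := by
      exact_mod_cast (Real.sqrt_pos.2 two_pos).ne'
    congr 1
    · norm_num
      field_simp
    · congr 1
      norm_num
      ring
  simp_rw [h]
  rw [integral_const_mul, integral_gaussian_complex hb, mul_pow]
  have h2 : ((Real.pi / (1 - t * Complex.I) : ℂ) ^ (1 / 2 : ℂ)) ^ 2 =
      Real.pi / (1 - t * Complex.I) := by
    simp
  have h3 : (((Real.sqrt Real.pi)⁻¹ : ℝ) : ℂ) ^ 2 = (Real.pi : ℂ)⁻¹ := by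
    rw [← Complex.ofReal_pow, inv_pow, Real.sq_sqrt Real.pi_pos.le]
    push_cast
    rfl
  rw [h2, h3]
  have : (Real.pi : ℂ) ≠ 0 := by exact_mod_cast Real.pi_ne_zero
  field_simp

/-- The squared modulus of a standard complex Gaussian variable is exponential: both laws have
characteristic function `1 / (1 - i t)`. -/
lemma map_norm_sq_complexGaussian :
    complexGaussian.map (fun z => ‖z‖ ^ 2) = expMeasure 1 := by
  have : IsProbabilityMeasure (complexGaussian.map (fun z : ℂ => ‖z‖ ^ 2)) :=
    Measure.isProbabilityMeasure_map (by fun_prop)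
  refine Measure.ext_of_charFun (funext fun t => ?_)
  rw [charFun_apply_real, charFun_apply_real, integral_map (by fun_prop) (by fun_prop),
    integral_complexGaussian]
  have hsplit : ∀ p : ℝ × ℝ,
      Complex.exp (t * ((‖(⟨p.1, p.2⟩ : ℂ)‖ ^ 2 : ℝ) : ℂ) * Complex.I) =
      Complex.exp (t * p.1 ^ 2 * Complex.I) * Complex.exp (t * p.2 ^ 2 * Complex.I) := by
    intro p
    rw [← Complex.exp_add, Complex.sq_norm, Complex.normSq_apply]
    congr 1
    push_cast
    ring
  simp_rw [hsplit]
  rw [integral_prod_mul (fun x : ℝ => Complex.exp (t * x ^ 2 * Complex.I))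
    (fun x : ℝ => Complex.exp (t * x ^ 2 * Complex.I)), ← sq,
    integral_cexp_mul_sq_gaussianReal, integral_expMeasure]
  have h : ∀ x : ℝ, Real.exp (-x) • Complex.exp (t * x * Complex.I) =
      Complex.exp ((-1 + t * Complex.I) * x) := by
    intro x
    rw [Complex.real_smul, Complex.ofReal_exp, ← Complex.exp_add]
    congr 1
    push_cast
    ring
  simp_rw [h]
  rw [integral_exp_mul_complex_Ioi (by simp)]
  have h1 : (1 - t * Complex.I) ≠ 0 := fun h => by simpa using congrArg Complex.re h
  have h2 : (-1 + t * Complex.I) ≠ 0 := fun h => by simpa using congrArg Complex.re h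
  simp only [Complex.ofReal_zero, mul_zero, Complex.exp_zero]
  rw [div_eq_div_iff h1 h2]
  ring

lemma map_norm_inner_sq {n : ℕ} {x : EuclideanSpace ℂ (Fin n)} (hx : ‖x‖ = 1) :
    (complexGaussianVector n).map (fun a => ‖inner ℂ a x‖ ^ 2) = expMeasure 1 := by
  rw [← map_norm_sq_complexGaussian, ← map_inner_complexGaussianVector hx,
    Measure.map_map (by fun_prop) (by fun_prop)]
  rfl

lemma integral_id_expMeasure : ∫ x, x ∂expMeasure 1 = 1 := by
  rw [integral_expMeasure]
  have h := Real.Gamma_eq_integral (s := 2) (by norm_num)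
  norm_num at h
  simpa using h.symm

lemma integral_exp_half_expMeasure : ∫ x, Real.exp (x / 2) ∂expMeasure 1 = 2 := by
  rw [integral_expMeasure]
  have h : ∀ x : ℝ, Real.exp (-x) • Real.exp (x / 2) = Real.exp (-(1 / 2) * x) := by
    intro x
    rw [smul_eq_mul, ← Real.exp_add]
    ring_nf
  simp_rw [h]
  rw [integral_exp_mul_Ioi (by norm_num)]
  norm_num

/-! ### Moments of linear functionals of a complex Gaussian vector -/

lemma integrable_exp_half_expMeasure :
    Integrable (fun x => Real.exp (x / 2)) (expMeasure 1) := by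
  by_contra h
  have := integral_undef h
  rw [integral_exp_half_expMeasure] at this
  norm_num at this

lemma integrable_id_expMeasure : Integrable (fun x : ℝ => x) (expMeasure 1) := by
  by_contra h
  have := integral_undef h
  rw [integral_id_expMeasure] at this
  norm_num at this

section

variable {n : ℕ}

lemma integrable_exp_norm_inner_sq {x : EuclideanSpace ℂ (Fin n)} (hx : ‖x‖ = 1) :
    Integrable (fun a => Real.exp (‖inner ℂ a x‖ ^ 2 / 2)) (complexGaussianVector n) := by
  have h := integrable_exp_half_expMeasure
  rw [← map_norm_inner_sq hx] at h
  exact h.comp_measurable (by fun_prop)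

lemma integral_exp_norm_inner_sq {x : EuclideanSpace ℂ (Fin n)} (hx : ‖x‖ = 1) :
    ∫ a, Real.exp (‖inner ℂ a x‖ ^ 2 / 2) ∂complexGaussianVector n = 2 := by
  have h := integral_exp_half_expMeasure
  rwa [← map_norm_inner_sq hx, integral_map (by fun_prop) (by fun_prop)] at h

lemma norm_inner_sq_eq_mul (a x : EuclideanSpace ℂ (Fin n)) :
    ‖inner ℂ a x‖ ^ 2 = ‖x‖ ^ 2 * ‖inner ℂ a (((‖x‖ : ℂ)⁻¹) • x)‖ ^ 2 := by
  rcases eq_or_ne x 0 with rfl | hx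
  · simp
  · have : ‖x‖ ≠ 0 := norm_ne_zero_iff.2 hx
    rw [inner_smul_right, norm_mul, norm_inv, Complex.norm_real, norm_norm]
    field_simp

lemma integrable_norm_inner_sq (x : EuclideanSpace ℂ (Fin n)) :
    Integrable (fun a => ‖inner ℂ a x‖ ^ 2) (complexGaussianVector n) := by
  rcases eq_or_ne x 0 with rfl | hx
  · simp
  · simp_rw [norm_inner_sq_eq_mul _ x]
    refine Integrable.const_mul ?_ _
    have h := integrable_id_expMeasure
    rw [← map_norm_inner_sq (norm_smul_inv_norm (𝕜 := ℂ) hx)] at h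
    exact h.comp_measurable (by fun_prop)

lemma integral_norm_inner_sq (x : EuclideanSpace ℂ (Fin n)) :
    ∫ a, ‖inner ℂ a x‖ ^ 2 ∂complexGaussianVector n = ‖x‖ ^ 2 := by
  rcases eq_or_ne x 0 with rfl | hx
  · simp
  · simp_rw [norm_inner_sq_eq_mul _ x]
    rw [integral_const_mul]
    have h := integral_id_expMeasure
    rw [← map_norm_inner_sq (norm_smul_inv_norm (𝕜 := ℂ) hx),
      integral_map (by fun_prop) (by fun_prop)] at h
    have h' : ∫ a, ‖inner ℂ a (((‖x‖ : ℂ)⁻¹) • x)‖ ^ 2 ∂complexGaussianVector n = 1 := h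
    rw [h', mul_one]

/-- `⟨a, x⟩` and `⟨a, -x⟩` have the same law, since the characteristic function of `⟨a, x⟩`
depends on `‖x‖` only. -/
lemma integral_inner_complexGaussianVector (x : EuclideanSpace ℂ (Fin n)) :
    ∫ a, inner ℂ a x ∂complexGaussianVector n = 0 := by
  have hprob : ∀ w : EuclideanSpace ℂ (Fin n),
      IsProbabilityMeasure ((complexGaussianVector n).map (fun a => inner ℂ a w)) :=
    fun w => Measure.isProbabilityMeasure_map (by fun_prop)
  have hmap : (complexGaussianVector n).map (fun a => inner ℂ a (-x)) =
      (complexGaussianVector n).map (fun a => inner ℂ a x) :=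
    Measure.ext_of_charFun (funext fun z => by
      rw [charFun_map_inner, charFun_map_inner, norm_neg])
  have h : ∫ a, inner ℂ a (-x) ∂complexGaussianVector n =
      ∫ a, inner ℂ a x ∂complexGaussianVector n := by
    have h1 := integral_map (μ := complexGaussianVector n) (φ := fun a => inner ℂ a (-x))
      (f := fun z : ℂ => z) (by fun_prop) (by fun_prop)
    have h2 := integral_map (μ := complexGaussianVector n) (φ := fun a => inner ℂ a x)
      (f := fun z : ℂ => z) (by fun_prop) (by fun_prop)
    rw [← h1, ← h2, hmap]
  simp_rw [inner_neg_right] at h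
  rw [integral_neg] at h
  exact self_eq_neg.1 h.symm

lemma norm_sub_inner_smul_sq {x₀ x : EuclideanSpace ℂ (Fin n)} (hx₀ : ‖x₀‖ = 1)
    (hx : ‖x‖ = 1) :
    ‖x - (inner ℂ x₀ x : ℂ) • x₀‖ ^ 2 = 1 - ‖inner ℂ x₀ x‖ ^ 2 := by
  rw [norm_sub_sq (𝕜 := ℂ), inner_smul_right, norm_smul, hx, hx₀, ← inner_conj_symm x x₀,
    Complex.mul_conj, Complex.normSq_eq_norm_sq]
  simp only [RCLike.re_to_complex, Complex.ofReal_re]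
  ring

/-- Conditionally on `⟨a, x₀⟩`, the intensity `|⟨a, x⟩|²` has mean
`|⟨x₀, x⟩|² |⟨a, x₀⟩|² + (1 - |⟨x₀, x⟩|²)`. -/
lemma integral_mul_norm_inner_sq {x₀ x : EuclideanSpace ℂ (Fin n)} (hx₀ : ‖x₀‖ = 1)
    (hx : ‖x‖ = 1) {g : ℂ → ℝ} (hg : Measurable g) (hg1 : ∀ z, |g z| ≤ 1) :
    ∫ a, g (inner ℂ a x₀) * ‖inner ℂ a x‖ ^ 2 ∂complexGaussianVector n =
      ‖inner ℂ x₀ x‖ ^ 2 *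
          ∫ a, g (inner ℂ a x₀) * ‖inner ℂ a x₀‖ ^ 2 ∂complexGaussianVector n +
        (1 - ‖inner ℂ x₀ x‖ ^ 2) * ∫ a, g (inner ℂ a x₀) ∂complexGaussianVector n := by
  set α : ℂ := inner ℂ x₀ x with hα
  set w := x - α • x₀ with hw
  have horth : inner ℂ x₀ w = 0 := by
    rw [hw, inner_sub_right, inner_smul_right, inner_self_eq_norm_sq_to_K, hx₀, ← hα]
    simp
  have hind := indepFun_inner_of_inner_eq_zero horth
  have hwn : ‖w‖ ^ 2 = 1 - ‖α‖ ^ 2 := norm_sub_inner_smul_sq hx₀ hx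
  have hsplit : ∀ a, g (inner ℂ a x₀) * ‖inner ℂ a x‖ ^ 2 =
      ‖α‖ ^ 2 * (g (inner ℂ a x₀) * ‖inner ℂ a x₀‖ ^ 2) +
        g (inner ℂ a x₀) * ‖inner ℂ a w‖ ^ 2 +
        2 * (((g (inner ℂ a x₀) : ℂ) * (α * inner ℂ a x₀)) *
          (starRingEnd ℂ) (inner ℂ a w)).re := by
    intro a
    have hxw : x = α • x₀ + w := by rw [hw]; abel
    have hin : (inner ℂ a x : ℂ) = α * inner ℂ a x₀ + inner ℂ a w := by
      conv_lhs => rw [hxw]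
      rw [inner_add_right, inner_smul_right]
    rw [hin, Complex.sq_norm, Complex.normSq_add, mul_assoc (g (inner ℂ a x₀) : ℂ),
      Complex.re_ofReal_mul, Complex.normSq_mul, Complex.sq_norm, Complex.sq_norm,
      Complex.sq_norm]
    ring
  have hbdd : ∀ v : EuclideanSpace ℂ (Fin n),
      Integrable (fun a => g (inner ℂ a x₀) * ‖inner ℂ a v‖ ^ 2)
        (complexGaussianVector n) := fun v =>
    (integrable_norm_inner_sq v).bdd_mul (c := 1)
      (hg.comp (f := fun a => (inner ℂ a x₀ : ℂ)) (by fun_prop)).aestronglyMeasurable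
      (.of_forall fun a => by simpa using hg1 _)
  have hcross : Integrable (fun a => ((g (inner ℂ a x₀) : ℂ) * (α * inner ℂ a x₀)) *
      (starRingEnd ℂ) (inner ℂ a w)) (complexGaussianVector n) := by
    refine (((integrable_norm_inner_sq x₀).const_mul (‖α‖ ^ 2)).add
      (integrable_norm_inner_sq w)).mono' (by fun_prop) (.of_forall fun a => ?_)
    rw [norm_mul, norm_mul, norm_mul, RCLike.norm_conj, Complex.norm_real, Real.norm_eq_abs]
    have h1 : |g (inner ℂ a x₀)| * (‖α‖ * ‖inner ℂ a x₀‖) ≤ ‖α‖ * ‖inner ℂ a x₀‖ :=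
      mul_le_of_le_one_left (by positivity) (hg1 _)
    have h2 := mul_le_mul_of_nonneg_right h1 (norm_nonneg (inner ℂ a w : ℂ))
    simp only [Pi.add_apply]
    nlinarith [sq_nonneg (‖α‖ * ‖(inner ℂ a x₀ : ℂ)‖ - ‖(inner ℂ a w : ℂ)‖),
      sq_nonneg (‖α‖ * ‖(inner ℂ a x₀ : ℂ)‖), sq_nonneg ‖(inner ℂ a w : ℂ)‖]
  have hcross0 : ∫ a, (((g (inner ℂ a x₀) : ℂ) * (α * inner ℂ a x₀)) *
      (starRingEnd ℂ) (inner ℂ a w)).re ∂complexGaussianVector n = 0 := by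
    have h1 := hind.integral_fun_comp_mul_comp (f := fun u : ℂ => (g u : ℂ) * (α * u))
      (g := fun v : ℂ => (starRingEnd ℂ) v) (by fun_prop) (by fun_prop)
      (by fun_prop) (by fun_prop)
    have h2 := integral_re hcross
    simp only [RCLike.re_to_complex] at h2
    rw [h2, h1, integral_conj, integral_inner_complexGaussianVector]
    simp
  have hindep2 : ∫ a, g (inner ℂ a x₀) * ‖inner ℂ a w‖ ^ 2 ∂complexGaussianVector n =
      (∫ a, g (inner ℂ a x₀) ∂complexGaussianVector n) * ‖w‖ ^ 2 := by
    rw [← integral_norm_inner_sq w]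
    exact hind.integral_fun_comp_mul_comp (f := g) (g := fun v : ℂ => ‖v‖ ^ 2)
      (by fun_prop) (by fun_prop) (by fun_prop) (by fun_prop)
  simp_rw [hsplit]
  have hc2 : Integrable (fun a => 2 * (((g (inner ℂ a x₀) : ℂ) * (α * inner ℂ a x₀)) *
      (starRingEnd ℂ) (inner ℂ a w)).re) (complexGaussianVector n) :=
    hcross.re.const_mul 2
  rw [integral_add (f := fun a => ‖α‖ ^ 2 * (g (inner ℂ a x₀) * ‖inner ℂ a x₀‖ ^ 2) +
        g (inner ℂ a x₀) * ‖inner ℂ a w‖ ^ 2)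
      (((hbdd x₀).const_mul _).add (hbdd w)) hc2,
    integral_add ((hbdd x₀).const_mul _) (hbdd w), integral_const_mul, integral_const_mul,
    hcross0, hindep2, hwn]
  ring

/-- `integral_mul_norm_inner_sq` with an additional independent variable. -/
lemma integral_prod_mul_norm_inner_sq {T : Type*} [MeasurableSpace T] (ρ : Measure T)
    [IsProbabilityMeasure ρ] {x₀ x : EuclideanSpace ℂ (Fin n)} (hx₀ : ‖x₀‖ = 1)
    (hx : ‖x‖ = 1) {g : ℂ → T → ℝ} (hg : Measurable (Function.uncurry g))
    (hg1 : ∀ z t, |g z t| ≤ 1) :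
    ∫ p, g (inner ℂ p.1 x₀) p.2 * ‖inner ℂ p.1 x‖ ^ 2 ∂(complexGaussianVector n).prod ρ =
      ‖inner ℂ x₀ x‖ ^ 2 *
          ∫ p, g (inner ℂ p.1 x₀) p.2 * ‖inner ℂ p.1 x₀‖ ^ 2
            ∂(complexGaussianVector n).prod ρ +
        (1 - ‖inner ℂ x₀ x‖ ^ 2) *
          ∫ p, g (inner ℂ p.1 x₀) p.2 ∂(complexGaussianVector n).prod ρ := by
  have hm : Measurable fun p : EuclideanSpace ℂ (Fin n) × T => g (inner ℂ p.1 x₀) p.2 :=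
    hg.comp (f := fun p : EuclideanSpace ℂ (Fin n) × T => ((inner ℂ p.1 x₀ : ℂ), p.2))
      (by fun_prop)
  have hI : ∀ v : EuclideanSpace ℂ (Fin n), Integrable
      (fun p : EuclideanSpace ℂ (Fin n) × T => g (inner ℂ p.1 x₀) p.2 * ‖inner ℂ p.1 v‖ ^ 2)
      ((complexGaussianVector n).prod ρ) := fun v =>
    ((integrable_norm_inner_sq v).comp_fst ρ).bdd_mul (c := 1) hm.aestronglyMeasurable
      (.of_forall fun p => by simpa using hg1 _ _)
  have hI0 : Integrable (fun p : EuclideanSpace ℂ (Fin n) × T => g (inner ℂ p.1 x₀) p.2)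
      ((complexGaussianVector n).prod ρ) :=
    (integrable_const (1 : ℝ)).mono' hm.aestronglyMeasurable
      (.of_forall fun p => by simpa using hg1 _ _)
  rw [integral_prod_symm _ (hI x), integral_prod_symm _ (hI x₀), integral_prod_symm _ hI0,
    ← integral_const_mul, ← integral_const_mul,
    ← integral_add ((hI x₀).integral_prod_right.const_mul _)
      (hI0.integral_prod_right.const_mul _)]
  refine integral_congr_ae (.of_forall fun t => ?_)
  exact integral_mul_norm_inner_sq hx₀ hx (g := fun z => g z t)
    (hg.comp (f := fun z => (z, t)) (by fun_prop)) (fun z => hg1 z t)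

end

/-! ### One sample -/

lemma measurable_sgn (τ : SignType) : Measurable (sgn τ) :=
  Measurable.ite measurableSet_Ioi measurable_const
    (Measurable.ite measurableSet_Iio measurable_const measurable_const)

lemma abs_sgn_le_one (τ : SignType) (t : ℝ) : |sgn τ t| ≤ 1 := by
  unfold sgn
  split_ifs
  · simp
  · simp
  · cases τ <;> simp

lemma abs_oneBit_le_one {S : Type*} {n : ℕ} {τ : SignType} {θ : ℝ → S → ℝ}
    (x₀ : EuclideanSpace ℂ (Fin n)) (A : Sample n S) : |oneBit τ θ x₀ A| ≤ 1 :=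
  abs_sgn_le_one _ _

/-- The quadratic form `x* M x` of the rank two matrix `M = y (a¹ a¹* - a² a²*)` that one sample
contributes. -/
noncomputable def contrast {S : Type*} {n : ℕ} (τ : SignType) (θ : ℝ → S → ℝ)
    (x₀ x : EuclideanSpace ℂ (Fin n)) (A : Sample n S) : ℝ :=
  oneBit τ θ x₀ A * (‖inner ℂ A.1.1 x‖ ^ 2 - ‖inner ℂ A.1.2 x‖ ^ 2)

lemma exp_abs_contrast_le {S : Type*} {n : ℕ} {τ : SignType} {θ : ℝ → S → ℝ}
    (x₀ x : EuclideanSpace ℂ (Fin n)) (A : Sample n S) :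
    Real.exp (|contrast τ θ x₀ x A| / 2) ≤
      Real.exp (‖inner ℂ A.1.1 x‖ ^ 2 / 2) * Real.exp (‖inner ℂ A.1.2 x‖ ^ 2 / 2) := by
  rw [← Real.exp_add]
  gcongr
  have h1 : |contrast τ θ x₀ x A| ≤ |‖inner ℂ A.1.1 x‖ ^ 2 - ‖inner ℂ A.1.2 x‖ ^ 2| := by
    rw [contrast, abs_mul]
    exact mul_le_of_le_one_left (abs_nonneg _) (abs_oneBit_le_one x₀ A)
  have h2 := abs_sub (‖inner ℂ A.1.1 x‖ ^ 2) (‖inner ℂ A.1.2 x‖ ^ 2)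
  rw [abs_of_nonneg (sq_nonneg ‖inner ℂ A.1.1 x‖),
    abs_of_nonneg (sq_nonneg ‖inner ℂ A.1.2 x‖)] at h2
  linarith

section

variable {S : Type*} [MeasurableSpace S] {n : ℕ} {τ : SignType} {θ : ℝ → S → ℝ}

instance (ν : Measure S) [IsProbabilityMeasure ν] : IsProbabilityMeasure (sampleLaw n ν) := by
  unfold sampleLaw
  infer_instance

lemma measurable_sgn_sub {T : Type*} [MeasurableSpace T] (hθ : Measurable (Function.uncurry θ))
    {z₁ z₂ : T → ℝ} {s₁ s₂ : T → S} (hz₁ : Measurable z₁) (hz₂ : Measurable z₂)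
    (hs₁ : Measurable s₁) (hs₂ : Measurable s₂) :
    Measurable fun p => sgn τ (θ (z₁ p) (s₁ p) - θ (z₂ p) (s₂ p)) :=
  (measurable_sgn τ).comp ((hθ.comp (hz₁.prodMk hs₁)).sub (hθ.comp (hz₂.prodMk hs₂)))

lemma measurable_oneBit (hθ : Measurable (Function.uncurry θ))
    (x₀ : EuclideanSpace ℂ (Fin n)) : Measurable (oneBit τ θ x₀) :=
  measurable_sgn_sub hθ (by fun_prop) (by fun_prop) (by fun_prop) (by fun_prop)

lemma measurable_contrast (hθ : Measurable (Function.uncurry θ))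
    (x₀ x : EuclideanSpace ℂ (Fin n)) : Measurable (contrast τ θ x₀ x) :=
  (measurable_oneBit hθ x₀).mul (by fun_prop)

lemma integrable_exp_abs_contrast (hθ : Measurable (Function.uncurry θ)) (ν : Measure S)
    [IsProbabilityMeasure ν] (x₀ : EuclideanSpace ℂ (Fin n)) {x : EuclideanSpace ℂ (Fin n)}
    (hx : ‖x‖ = 1) :
    Integrable (fun A => Real.exp (|contrast τ θ x₀ x A| / 2)) (sampleLaw n ν) ∧
      ∫ A, Real.exp (|contrast τ θ x₀ x A| / 2) ∂sampleLaw n ν ≤ 4 := by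
  have hG := integrable_exp_norm_inner_sq hx
  have hI : Integrable (fun A : Sample n S =>
      Real.exp (‖inner ℂ A.1.1 x‖ ^ 2 / 2) * Real.exp (‖inner ℂ A.1.2 x‖ ^ 2 / 2))
      (sampleLaw n ν) := (hG.mul_prod hG).comp_fst (ν.prod ν)
  have hm := measurable_contrast (τ := τ) hθ x₀ x
  have hI' : Integrable (fun A => Real.exp (|contrast τ θ x₀ x A| / 2)) (sampleLaw n ν) := by
    refine hI.mono' (by fun_prop) (.of_forall fun A => ?_)
    rw [Real.norm_eq_abs, Real.abs_exp]
    exact exp_abs_contrast_le x₀ x A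
  refine ⟨hI', (integral_mono hI' hI fun A => exp_abs_contrast_le x₀ x A).trans ?_⟩
  rw [sampleLaw, integral_fun_fst (fun p : EuclideanSpace ℂ (Fin n) × EuclideanSpace ℂ (Fin n) =>
    Real.exp (‖inner ℂ p.1 x‖ ^ 2 / 2) * Real.exp (‖inner ℂ p.2 x‖ ^ 2 / 2)),
    integral_prod_mul (fun a => Real.exp (‖inner ℂ a x‖ ^ 2 / 2))
      (fun a => Real.exp (‖inner ℂ a x‖ ^ 2 / 2)), integral_exp_norm_inner_sq hx]
  norm_num

lemma integrable_contrast (hθ : Measurable (Function.uncurry θ)) (ν : Measure S)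
    [IsProbabilityMeasure ν] (x₀ : EuclideanSpace ℂ (Fin n)) {x : EuclideanSpace ℂ (Fin n)}
    (hx : ‖x‖ = 1) : Integrable (contrast τ θ x₀ x) (sampleLaw n ν) := by
  refine ((integrable_exp_abs_contrast (τ := τ) hθ ν x₀ hx).1.const_mul 2).mono'
    (measurable_contrast hθ x₀ x).aestronglyMeasurable (.of_forall fun A => ?_)
  have := Real.add_one_le_exp (|contrast τ θ x₀ x A| / 2)
  rw [Real.norm_eq_abs]
  linarith

lemma integral_oneBit_mul_fst (hθ : Measurable (Function.uncurry θ)) (ν : Measure S)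
    [IsProbabilityMeasure ν] {x₀ x : EuclideanSpace ℂ (Fin n)} (hx₀ : ‖x₀‖ = 1) (hx : ‖x‖ = 1) :
    ∫ A, oneBit τ θ x₀ A * ‖inner ℂ A.1.1 x‖ ^ 2 ∂sampleLaw n ν =
      ‖inner ℂ x₀ x‖ ^ 2 * ∫ A, oneBit τ θ x₀ A * ‖inner ℂ A.1.1 x₀‖ ^ 2 ∂sampleLaw n ν +
        (1 - ‖inner ℂ x₀ x‖ ^ 2) * ∫ A, oneBit τ θ x₀ A ∂sampleLaw n ν := by
  have hmp := measurePreserving_prodAssoc (complexGaussianVector n) (complexGaussianVector n)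
    (ν.prod ν)
  have h := integral_prod_mul_norm_inner_sq ((complexGaussianVector n).prod (ν.prod ν)) hx₀ hx
    (g := fun z t => sgn τ (θ (‖z‖ ^ 2) t.2.1 - θ (‖inner ℂ t.1 x₀‖ ^ 2) t.2.2))
    (measurable_sgn_sub hθ (by fun_prop) (by fun_prop) (by fun_prop) (by fun_prop))
    (fun _ _ => abs_sgn_le_one _ _)
  rw [← hmp.integral_comp', ← hmp.integral_comp', ← hmp.integral_comp'] at h
  exact h

lemma integral_oneBit_mul_snd (hθ : Measurable (Function.uncurry θ)) (ν : Measure S)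
    [IsProbabilityMeasure ν] {x₀ x : EuclideanSpace ℂ (Fin n)} (hx₀ : ‖x₀‖ = 1) (hx : ‖x‖ = 1) :
    ∫ A, oneBit τ θ x₀ A * ‖inner ℂ A.1.2 x‖ ^ 2 ∂sampleLaw n ν =
      ‖inner ℂ x₀ x‖ ^ 2 * ∫ A, oneBit τ θ x₀ A * ‖inner ℂ A.1.2 x₀‖ ^ 2 ∂sampleLaw n ν +
        (1 - ‖inner ℂ x₀ x‖ ^ 2) * ∫ A, oneBit τ θ x₀ A ∂sampleLaw n ν := by
  have hswap : MeasurePreserving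
      (MeasurableEquiv.prodCongr MeasurableEquiv.prodComm (MeasurableEquiv.refl (S × S)))
      (sampleLaw n ν) (sampleLaw n ν) :=
    (Measure.measurePreserving_swap (μ := complexGaussianVector n)
      (ν := complexGaussianVector n)).prod (MeasurePreserving.id (ν.prod ν))
  have hmp : MeasurePreserving MeasurableEquiv.prodAssoc (sampleLaw n ν)
      ((complexGaussianVector n).prod ((complexGaussianVector n).prod (ν.prod ν))) :=
    measurePreserving_prodAssoc _ _ _
  have hmp' := hswap.trans hmp
  have h := integral_prod_mul_norm_inner_sq ((complexGaussianVector n).prod (ν.prod ν)) hx₀ hx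
    (g := fun z t => sgn τ (θ (‖inner ℂ t.1 x₀‖ ^ 2) t.2.1 - θ (‖z‖ ^ 2) t.2.2))
    (measurable_sgn_sub hθ (by fun_prop) (by fun_prop) (by fun_prop) (by fun_prop))
    (fun _ _ => abs_sgn_le_one _ _)
  rw [← hmp'.integral_comp', ← hmp'.integral_comp', ← hmp'.integral_comp'] at h
  exact h

/-- For `x = x₀` the intensities are exponential, and the mean contrast is the
signal-to-noise parameter. -/
lemma integral_contrast_self (hθ : Measurable (Function.uncurry θ)) (ν : Measure S)
    [IsProbabilityMeasure ν] {x₀ : EuclideanSpace ℂ (Fin n)} (hx₀ : ‖x₀‖ = 1) :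
    ∫ A, contrast τ θ x₀ x₀ A ∂sampleLaw n ν = snr τ ν θ := by
  have hf : Measurable fun a : EuclideanSpace ℂ (Fin n) => ‖inner ℂ a x₀‖ ^ 2 := by fun_prop
  have hmap : (sampleLaw n ν).map
      (Prod.map (Prod.map (fun a => ‖inner ℂ a x₀‖ ^ 2) (fun a => ‖inner ℂ a x₀‖ ^ 2)) id) =
        ((expMeasure 1).prod (expMeasure 1)).prod (ν.prod ν) := by
    rw [sampleLaw, ← Measure.map_prod_map _ _ (hf.prodMap hf) measurable_id,
      ← Measure.map_prod_map _ _ hf hf, map_norm_inner_sq hx₀, Measure.map_id]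
  rw [snr, ← hmap, integral_map (by fun_prop)]
  · rfl
  · exact ((measurable_sgn_sub hθ (by fun_prop) (by fun_prop) (by fun_prop)
      (by fun_prop)).mul (by fun_prop)).aestronglyMeasurable

/-- The mean of the quadratic form is that of `λ x₀ x₀*`: the component of `x` orthogonal to `x₀`
contributes equally to both intensities and cancels. -/
lemma integral_contrast (hθ : Measurable (Function.uncurry θ)) (ν : Measure S)
    [IsProbabilityMeasure ν] {x₀ x : EuclideanSpace ℂ (Fin n)} (hx₀ : ‖x₀‖ = 1) (hx : ‖x‖ = 1) :
    ∫ A, contrast τ θ x₀ x A ∂sampleLaw n ν = snr τ ν θ * ‖inner ℂ x₀ x‖ ^ 2 := by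
  have h1 : ∀ v : EuclideanSpace ℂ (Fin n), Integrable
      (fun A => oneBit τ θ x₀ A * ‖inner ℂ A.1.1 v‖ ^ 2) (sampleLaw n ν) := fun v =>
    (((integrable_norm_inner_sq v).comp_fst (complexGaussianVector n)).comp_fst
      (ν.prod ν)).bdd_mul (c := 1) (measurable_oneBit hθ x₀).aestronglyMeasurable
      (.of_forall fun A => abs_oneBit_le_one x₀ A)
  have h2 : ∀ v : EuclideanSpace ℂ (Fin n), Integrable
      (fun A => oneBit τ θ x₀ A * ‖inner ℂ A.1.2 v‖ ^ 2) (sampleLaw n ν) := fun v =>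
    (((integrable_norm_inner_sq v).comp_snd (complexGaussianVector n)).comp_fst
      (ν.prod ν)).bdd_mul (c := 1) (measurable_oneBit hθ x₀).aestronglyMeasurable
      (.of_forall fun A => abs_oneBit_le_one x₀ A)
  rw [← integral_contrast_self hθ ν hx₀]
  simp_rw [contrast, mul_sub]
  rw [integral_sub (h1 x) (h2 x), integral_sub (h1 x₀) (h2 x₀),
    integral_oneBit_mul_fst hθ ν hx₀ hx, integral_oneBit_mul_snd hθ ν hx₀ hx]
  ring

lemma snr_le (hθ : Measurable (Function.uncurry θ)) (ν : Measure S)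
    [IsProbabilityMeasure ν] {x₀ : EuclideanSpace ℂ (Fin n)} (hx₀ : ‖x₀‖ = 1) :
    snr τ ν θ ≤ 8 := by
  obtain ⟨hI, hle⟩ := integrable_exp_abs_contrast (τ := τ) hθ ν x₀ hx₀
  rw [← integral_contrast_self hθ ν hx₀]
  calc ∫ A, contrast τ θ x₀ x₀ A ∂sampleLaw n ν
      ≤ ∫ A, 2 * Real.exp (|contrast τ θ x₀ x₀ A| / 2) ∂sampleLaw n ν := by
        refine integral_mono (integrable_contrast hθ ν x₀ hx₀) (hI.const_mul 2) fun A => ?_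
        have := Real.add_one_le_exp (|contrast τ θ x₀ x₀ A| / 2)
        have := le_abs_self (contrast τ θ x₀ x₀ A)
        dsimp only
        linarith
    _ ≤ 8 := by rw [integral_const_mul]; linarith

end

/-! ### The empirical matrix -/

lemma star_dotProduct_outer_mulVec {n : ℕ} (a x : EuclideanSpace ℂ (Fin n)) :
    star x.ofLp ⬝ᵥ (outer a).mulVec x.ofLp = ((‖inner ℂ a x‖ ^ 2 : ℝ) : ℂ) := by
  have h1 : star a.ofLp ⬝ᵥ x.ofLp = inner ℂ a x := by
    rw [EuclideanSpace.inner_eq_star_dotProduct, dotProduct_comm]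
  have h2 : star x.ofLp ⬝ᵥ a.ofLp = inner ℂ x a := by
    rw [EuclideanSpace.inner_eq_star_dotProduct, dotProduct_comm]
  rw [outer, Matrix.vecMulVec_mulVec, h1, dotProduct_smul, h2, ← inner_conj_symm x a]
  simp [← Complex.normSq_eq_norm_sq, mul_comm, Complex.normSq_eq_conj_mul_self]

lemma re_star_dotProduct_empiricalMatrix {S : Type*} {n m : ℕ} (τ : SignType) (θ : ℝ → S → ℝ)
    (x₀ x : EuclideanSpace ℂ (Fin n)) (A : Fin m → Sample n S) :
    (star x.ofLp ⬝ᵥ (empiricalMatrix τ θ x₀ A).mulVec x.ofLp).re =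
      (1 / m : ℝ) * ∑ i, contrast τ θ x₀ x (A i) := by
  have h : star x.ofLp ⬝ᵥ (empiricalMatrix τ θ x₀ A).mulVec x.ofLp =
      (((1 / m : ℝ) * ∑ i, contrast τ θ x₀ x (A i) : ℝ) : ℂ) := by
    rw [empiricalMatrix, Matrix.smul_mulVec, dotProduct_smul, Matrix.sum_mulVec,
      dotProduct_sum]
    simp_rw [Matrix.smul_mulVec, dotProduct_smul, Matrix.sub_mulVec, dotProduct_sub,
      star_dotProduct_outer_mulVec, contrast]
    push_cast
    simp
  rw [h, Complex.ofReal_re]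

lemma norm_inner_smul_add_smul_sq {n : ℕ} (a x y : EuclideanSpace ℂ (Fin n)) (r s : ℝ) :
    ‖inner ℂ a (r • x + s • y)‖ ^ 2 = r ^ 2 * ‖inner ℂ a x‖ ^ 2 + s ^ 2 * ‖inner ℂ a y‖ ^ 2 +
      r * s * (2 * ((inner ℂ a x) * (starRingEnd ℂ) (inner ℂ a y)).re) := by
  have h : (inner ℂ a (r • x + s • y) : ℂ) = r * inner ℂ a x + s * inner ℂ a y := by
    rw [inner_add_right, ← inner_smul_right, ← inner_smul_right]
    rfl
  rw [h]
  generalize (inner ℂ a x : ℂ) = u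
  generalize (inner ℂ a y : ℂ) = v
  simp only [Complex.sq_norm, Complex.normSq_apply]
  simp
  ring

/-- If the quadratic form of the empirical matrix is close to that of `λ x₀ x₀*` on a net of the
sphere, then it is close on the whole sphere. -/
lemma abs_mean_contrast_sub_le_of_net {S : Type*} {n m : ℕ} (τ : SignType) (θ : ℝ → S → ℝ)
    (x₀ : EuclideanSpace ℂ (Fin n)) (A : Fin m → Sample n S) (lam : ℝ)
    {N : Finset (EuclideanSpace ℂ (Fin n))} (hN : ∀ y ∈ N, ‖y‖ = 1)
    (hnet : ∀ x : EuclideanSpace ℂ (Fin n), ‖x‖ = 1 → ∃ y ∈ N, ‖x - y‖ ≤ 1 / 2) {t : ℝ}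
    (ht : ∀ y ∈ N, |(1 / m : ℝ) * ∑ i, contrast τ θ x₀ y (A i) -
      lam * ‖inner ℂ x₀ y‖ ^ 2| ≤ t)
    {x : EuclideanSpace ℂ (Fin n)} (hx : ‖x‖ = 1) :
    |(1 / m : ℝ) * ∑ i, contrast τ θ x₀ x (A i) - lam * ‖inner ℂ x₀ x‖ ^ 2| ≤ 32 * t := by
  let c : EuclideanSpace ℂ (Fin n) → EuclideanSpace ℂ (Fin n) → EuclideanSpace ℂ (Fin n) → ℝ :=
    fun a x y => 2 * ((inner ℂ a x) * (starRingEnd ℂ) (inner ℂ a y)).re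
  refine abs_le_of_net (q := fun x => (1 / m : ℝ) * ∑ i, contrast τ θ x₀ x (A i) -
      lam * ‖inner ℂ x₀ x‖ ^ 2)
    (B := fun x y => (1 / m : ℝ) * ∑ i, oneBit τ θ x₀ (A i) *
      (c (A i).1.1 x y - c (A i).1.2 x y) - lam * c x₀ x y) ?_ ?_ hN hnet ht hx
  · unfold contrast
    fun_prop
  · intro r s x y
    have hs : ∑ i, contrast τ θ x₀ (r • x + s • y) (A i) =
        r ^ 2 * ∑ i, contrast τ θ x₀ x (A i) + s ^ 2 * ∑ i, contrast τ θ x₀ y (A i) +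
          r * s * ∑ i, oneBit τ θ x₀ (A i) * (c (A i).1.1 x y - c (A i).1.2 x y) := by
      rw [Finset.mul_sum, Finset.mul_sum, Finset.mul_sum, ← Finset.sum_add_distrib,
        ← Finset.sum_add_distrib]
      refine Finset.sum_congr rfl fun i _ => ?_
      rw [contrast, norm_inner_smul_add_smul_sq, norm_inner_smul_add_smul_sq, contrast, contrast]
      ring
    rw [hs, norm_inner_smul_add_smul_sq]
    ring

/-- Two unit vectors with a large inner product are close up to a phase. -/
lemma exists_phase_norm_sub_sq_le {n : ℕ} {x₀ x : EuclideanSpace ℂ (Fin n)} (hx₀ : ‖x₀‖ = 1)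
    (hx : ‖x‖ = 1) {δ : ℝ} (h : 1 - δ ≤ ‖inner ℂ x₀ x‖ ^ 2) :
    ∃ φ ∈ Set.Icc (0 : ℝ) (2 * Real.pi),
      ‖x - Complex.exp (Complex.I * φ) • x₀‖ ^ 2 ≤ 2 * δ := by
  set c : ℂ := inner ℂ x₀ x with hc
  have hc1 : ‖c‖ ≤ 1 := by
    have := norm_inner_le_norm (𝕜 := ℂ) x₀ x
    rwa [hx₀, hx, one_mul] at this
  have hphase : ∃ φ ∈ Set.Icc (0 : ℝ) (2 * Real.pi),
      Complex.exp (Complex.I * φ) = Complex.exp (c.arg * Complex.I) := by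
    rcases le_or_gt 0 c.arg with h0 | h0
    · exact ⟨c.arg, ⟨h0, by linarith [Complex.arg_le_pi c, Real.pi_pos]⟩, by rw [mul_comm]⟩
    · refine ⟨c.arg + 2 * Real.pi,
        ⟨by linarith [Complex.neg_pi_lt_arg c, Real.pi_pos], by linarith⟩, ?_⟩
      rw [← Complex.exp_periodic (c.arg * Complex.I)]
      congr 1
      push_cast
      ring
  obtain ⟨φ, hφ, he⟩ := hphase
  refine ⟨φ, hφ, ?_⟩
  have hconj : (starRingEnd ℂ) c = ‖c‖ * Complex.exp (-(c.arg * Complex.I)) := by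
    have := congrArg (starRingEnd ℂ) (Complex.norm_mul_exp_arg_mul_I c).symm
    rwa [map_mul, Complex.conj_ofReal, ← Complex.exp_conj, map_mul, Complex.conj_ofReal,
      Complex.conj_I, mul_neg] at this
  have hin : inner ℂ x (Complex.exp (Complex.I * φ) • x₀) = ((‖c‖ : ℝ) : ℂ) := by
    rw [inner_smul_right, ← inner_conj_symm, ← hc, he, hconj, mul_left_comm, ← Complex.exp_add,
      add_neg_cancel, Complex.exp_zero, mul_one]
  rw [norm_sub_sq (𝕜 := ℂ), hin, norm_smul, he, Complex.norm_exp_ofReal_mul_I, hx, hx₀]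
  simp only [RCLike.re_to_complex, Complex.ofReal_re]
  nlinarith [norm_nonneg c]

/-! ### Concentration of the empirical matrix -/

/-- Bernstein's inequality for the empirical quadratic form at a fixed unit vector. -/
lemma measureReal_mean_contrast_sub_ge_le {S : Type*} [MeasurableSpace S] {n m : ℕ}
    {τ : SignType} {θ : ℝ → S → ℝ} (hθ : Measurable (Function.uncurry θ)) {ν : Measure S}
    [IsProbabilityMeasure ν] {Ω : Type*} [MeasurableSpace Ω] {P : Measure Ω}
    [IsProbabilityMeasure P] {A : Fin m → Ω → Sample n S}
    (hA : ∀ i, HasLaw (A i) (sampleLaw n ν) P) (hindep : iIndepFun A P) (hm : 0 < m)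
    {x₀ x : EuclideanSpace ℂ (Fin n)} (hx₀ : ‖x₀‖ = 1) (hx : ‖x‖ = 1) {t : ℝ} (ht : 0 ≤ t)
    (ht' : t ≤ 64) :
    P.real {ω | t ≤ |(1 / m : ℝ) * ∑ i, contrast τ θ x₀ x (A i ω) -
      snr τ ν θ * ‖inner ℂ x₀ x‖ ^ 2|} ≤ 2 * Real.exp (-(m * t ^ 2 / 512)) := by
  have hc := measurable_contrast (τ := τ) hθ x₀ x
  obtain ⟨hI, hle⟩ := integrable_exp_abs_contrast (τ := τ) hθ ν x₀ hx
  have hX : ∀ i, AEMeasurable (fun ω => contrast τ θ x₀ x (A i ω)) P := fun i =>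
    hc.comp_aemeasurable (hA i).aemeasurable
  refine measureReal_mean_sub_ge_le hm hX (hindep.comp (fun _ => contrast τ θ x₀ x) fun _ => hc)
    (fun i => ?_) (fun i => ?_) (fun i => ?_) ht ht'
  · rw [← (hA i).map_eq] at hI
    exact hI.comp_aemeasurable (hA i).aemeasurable
  · rwa [← (hA i).map_eq, integral_map (hA i).aemeasurable (by fun_prop)] at hle
  · rw [← integral_contrast hθ ν hx₀ hx, ← (hA i).map_eq,
      integral_map (hA i).aemeasurable hc.aestronglyMeasurable]

/-- A union bound over a net of the complex sphere, which has at most `5 ^ (2 n)` points. -/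
lemma measureReal_exists_net_le {S : Type*} [MeasurableSpace S] {n m : ℕ}
    {τ : SignType} {θ : ℝ → S → ℝ} (hθ : Measurable (Function.uncurry θ)) {ν : Measure S}
    [IsProbabilityMeasure ν] {Ω : Type*} [MeasurableSpace Ω] {P : Measure Ω}
    [IsProbabilityMeasure P] {A : Fin m → Ω → Sample n S}
    (hA : ∀ i, HasLaw (A i) (sampleLaw n ν) P) (hindep : iIndepFun A P) (hm : 0 < m)
    {x₀ : EuclideanSpace ℂ (Fin n)} (hx₀ : ‖x₀‖ = 1) {t : ℝ} (ht : 0 ≤ t) (ht' : t ≤ 64) :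
    ∃ U : Set Ω, P.real U ≤ 5 ^ (2 * n) * (2 * Real.exp (-(m * t ^ 2 / 512))) ∧
      ∀ ω ∉ U, ∀ x : EuclideanSpace ℂ (Fin n), ‖x‖ = 1 →
        |(1 / m : ℝ) * ∑ i, contrast τ θ x₀ x (A i ω) - snr τ ν θ * ‖inner ℂ x₀ x‖ ^ 2| ≤
          32 * t := by
  obtain ⟨N, hcard, hN, hnet⟩ := exists_half_net_sphere (EuclideanSpace ℂ (Fin n))
  rw [finrank_real_of_complex, finrank_euclideanSpace_fin] at hcard
  refine ⟨⋃ y ∈ N, {ω | t ≤ |(1 / m : ℝ) * ∑ i, contrast τ θ x₀ y (A i ω) -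
      snr τ ν θ * ‖inner ℂ x₀ y‖ ^ 2|}, ?_, ?_⟩
  · refine (measureReal_biUnion_finset_le N _).trans ?_
    refine (Finset.sum_le_card_nsmul N _ _ fun y hy =>
      measureReal_mean_contrast_sub_ge_le hθ hA hindep hm hx₀ (hN y hy) ht ht').trans ?_
    rw [nsmul_eq_mul]
    gcongr
    exact_mod_cast hcard
  · intro ω hω x hx
    refine abs_mean_contrast_sub_le_of_net τ θ x₀ (fun i => A i ω) _ hN hnet (fun y hy => ?_) hx
    simp only [Set.mem_iUnion, not_exists] at hω
    exact (not_le.1 (hω y hy)).le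

/-- A top eigenvector of a matrix whose quadratic form is within `λ ε / 4` of that of `λ x₀ x₀*`
is close to `x₀` up to a phase. -/
lemma exists_phase_of_isTopEigenvector {n : ℕ} {M : Matrix (Fin n) (Fin n) ℂ}
    {x₀ x : EuclideanSpace ℂ (Fin n)} (hx₀ : ‖x₀‖ = 1) {lam ε : ℝ} (hlam : 0 < lam)
    (hM : ∀ z : EuclideanSpace ℂ (Fin n), ‖z‖ = 1 →
      |(star z.ofLp ⬝ᵥ M.mulVec z.ofLp).re - lam * ‖inner ℂ x₀ z‖ ^ 2| ≤ lam * ε / 4)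
    (hx : IsTopEigenvector M x) :
    ∃ φ ∈ Set.Icc (0 : ℝ) (2 * Real.pi),
      ‖x - Complex.exp (Complex.I * φ) • x₀‖ ^ 2 ≤ ε := by
  have h0 := (abs_le.1 (hM x₀ hx₀)).1
  have h1 := (abs_le.1 (hM x hx.1)).2
  have h2 := hx.2 x₀ hx₀
  rw [inner_self_eq_norm_sq_to_K, hx₀] at h0
  norm_num at h0
  have h3 : 1 - ε / 2 ≤ ‖inner ℂ x₀ x‖ ^ 2 := by
    refine le_of_mul_le_mul_left ?_ hlam
    linarith
  obtain ⟨φ, hφ, h⟩ := exists_phase_norm_sub_sq_le hx₀ hx.1 h3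
  exact ⟨φ, hφ, by linarith⟩

lemma five_pow_mul_exp_le {n : ℕ} (hn : 0 < n) :
    (5 : ℝ) ^ (2 * n) * (2 * Real.exp (-(6 * n))) ≤ 2 / (n : ℝ) ^ 2 := by
  have hn' : (0 : ℝ) < n := by exact_mod_cast hn
  have h5 : (5 : ℝ) ≤ Real.exp 2 := by
    have := Real.quadratic_le_exp_of_nonneg (x := 2) (by norm_num)
    norm_num at this
    exact this
  have h52 : (5 : ℝ) ^ (2 * n) ≤ Real.exp (4 * n) := by
    calc (5 : ℝ) ^ (2 * n) ≤ Real.exp 2 ^ (2 * n) := by gcongr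
      _ = Real.exp (4 * n) := by
        rw [← Real.exp_nat_mul]
        push_cast
        ring_nf
  have hsq : (n : ℝ) ^ 2 ≤ Real.exp (2 * n) := by
    have h1 : (n : ℝ) ≤ Real.exp n := by linarith [Real.add_one_le_exp (n : ℝ)]
    calc (n : ℝ) ^ 2 ≤ Real.exp n ^ 2 := by gcongr
      _ = Real.exp (2 * n) := by
        rw [← Real.exp_nat_mul]
        push_cast
        rfl
  calc (5 : ℝ) ^ (2 * n) * (2 * Real.exp (-(6 * n)))
      ≤ Real.exp (4 * n) * (2 * Real.exp (-(6 * n))) := by gcongr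
    _ = 2 * Real.exp (-(2 * n)) := by
        rw [mul_left_comm, ← Real.exp_add]
        ring_nf
    _ = 2 / Real.exp (2 * n) := by rw [Real.exp_neg, div_eq_mul_inv]
    _ ≤ 2 / (n : ℝ) ^ 2 := by gcongr

end OneBitPhase

theorem theorem1 :
    ∃ C : ℝ, 0 < C ∧ ∃ K : ℝ, 0 < K ∧ ∀ lam : ℝ, 0 < lam → ∃ N : ℕ,
      ∀ (S : Type*) [MeasurableSpace S] (ν : Measure S) [IsProbabilityMeasure ν]
        (θ : ℝ → S → ℝ) (_ : Measurable (Function.uncurry θ)) (τ : SignType)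
        (_ : OneBitPhase.snr τ ν θ = lam)
        (n : ℕ) (_ : N ≤ n) (x₀ : EuclideanSpace ℂ (Fin n)) (_ : ‖x₀‖ = 1)
        (ε : ℝ) (_ : 0 < ε) (_ : ε ≤ 1)
        (m : ℕ) (_ : C / (ε ^ 2 * lam) * (n * Real.log n) ≤ (m : ℝ))
        (Ω : Type*) [MeasurableSpace Ω] (P : Measure Ω) [IsProbabilityMeasure P]
        (A : Fin m → Ω → OneBitPhase.Sample n S)
        (_ : ∀ i, HasLaw (A i) (OneBitPhase.sampleLaw n ν) P)
        (_ : iIndepFun A P),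
        P {ω | ¬ ∀ x : EuclideanSpace ℂ (Fin n),
            OneBitPhase.IsTopEigenvector
              (OneBitPhase.empiricalMatrix τ θ x₀ (fun i => A i ω)) x →
            ∃ φ ∈ Set.Icc (0 : ℝ) (2 * Real.pi),
              ‖x - Complex.exp (Complex.I * φ) • x₀‖ ^ 2 ≤ ε}
          ≤ ENNReal.ofReal (K / (n : ℝ) ^ 2) := by
  refine ⟨1, one_pos, 2, two_pos, fun lam hlam => ?_⟩
  -- `N` is such that `λ log n ≥ 6 · 2 ^ 23` for `n ≥ N`; with `t = λ ε / 128` this gives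
  -- `m t ^ 2 / 512 = m λ ^ 2 ε ^ 2 / 2 ^ 23 ≥ 6 n`, which beats the `5 ^ (2 n)` points of the net
  refine ⟨⌈Real.exp (6 * 2 ^ 23 / lam)⌉₊, ?_⟩
  intro S _ ν _ θ hθ τ hsnr n hNn x₀ hx₀ ε hε hε1 m hm Ω _ P _ A hA hindep
  have hexp : Real.exp (6 * 2 ^ 23 / lam) ≤ n := Nat.ceil_le.1 hNn
  have hn : (0 : ℝ) < n := (Real.exp_pos _).trans_le hexp
  have hlog : 6 * 2 ^ 23 ≤ lam * Real.log n := by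
    have := (Real.le_log_iff_exp_le hn).2 hexp
    rwa [div_le_iff₀' hlam] at this
  have hlogpos : 0 < Real.log n := by
    by_contra! h
    nlinarith
  have hm0 : (0 : ℝ) < m := lt_of_lt_of_le (by positivity) hm
  have hm' : n * Real.log n ≤ m * (ε ^ 2 * lam) := by
    rw [div_mul_eq_mul_div, one_mul, div_le_iff₀ (by positivity)] at hm
    exact hm
  have hlam8 : lam ≤ 8 := hsnr ▸ OneBitPhase.snr_le hθ ν hx₀
  obtain ⟨U, hU, hgood⟩ := OneBitPhase.measureReal_exists_net_le (τ := τ) hθ hA hindep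
    (by exact_mod_cast hm0) hx₀ (t := lam * ε / 128) (by positivity) (by nlinarith)
  rw [hsnr] at hgood
  refine (measure_mono (t := U) fun ω hω => ?_).trans ?_
  · by_contra hωU
    refine hω fun x hx => OneBitPhase.exists_phase_of_isTopEigenvector hx₀ hlam
      (fun z hz => ?_) hx
    rw [OneBitPhase.re_star_dotProduct_empiricalMatrix]
    refine (hgood ω hωU z hz).trans_eq ?_
    ring
  · rw [← ofReal_measureReal]
    refine ENNReal.ofReal_le_ofReal (hU.trans (le_trans ?_
      (OneBitPhase.five_pow_mul_exp_le (by exact_mod_cast hn))))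
    have hexpo : 6 * (n : ℝ) ≤ m * (lam * ε / 128) ^ 2 / 512 := by
      have h1 : lam * (n * Real.log n) ≤ lam * (m * (ε ^ 2 * lam)) := by gcongr
      have h2 : (n : ℝ) * (6 * 2 ^ 23) ≤ n * (lam * Real.log n) := by gcongr
      nlinarith
    gcongr
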